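/- Let $\mathcal S,\mathcal A$ be measurable spaces and consider a constrained Markov decision process with transition kernel $P(\cdot\mid s,a)$, initial distribution $\rho$ on $\mathcal S$, discount factor $\gamma\in(0,1)$, measurable reward $r_0:\mathcal S\times\mathcal A\to[0,1]$ and measurable utilities $r_1,\dots,r_m:\mathcal S\times\mathcal A\to[-1,1]$. For a stationary stochastic policy $\pi$ (a probability kernel from $\mathcal S$ to $\mathcal A$) let $$V_i^\pi(\rho)=\mathbb E\Big[\sum_{t\ge0}\gamma^t r_i(s_t,a_t)\Big],\qquad s_0\sim\rho,\ a_t\sim\pi(\cdot\mid s_t),\ s_{t+1}\sim P(\cdot\mid s_t,a_t),$$ let $V_i^\pi(s)$ and $Q_i^\pi(s,a)$ be the same expectation started from $s_0=s$, respectively from $(s_0,a_0)=(s,a)$, let $A_i^\pi(s,a)=Q_i^\pi(s,a)-V_i^\pi(s)$, and let $d_\rho^\pi=(1-\gamma)\sum_{t\ge0}\gamma^t\,\mathrm{Law}(s_t,a_t)$. Let $\pi^*$ be a stationary policy that maximizes $V_0^\pi(\rho)$ over all stationary policies $\pi$ with $V_i^\pi(\rho)\ge0$ for $i=1,\dots,m$.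 Let $\{\pi_\theta\}_{\theta\in\mathbb R^d}$ be a parameterized family of stationary policies with positive densities $\pi_\theta(a\mid s)$, measurable in $(s,a)$, with respect to a $\sigma$-finite reference measure on $\mathcal A$, such that $\theta\mapsto\log\pi_\theta(a\mid s)$ is differentiable for all $s,a$. Write $V_i^\theta=V_i^{\pi_\theta}(\rho)$, $A_i^\theta=A_i^{\pi_\theta}$, $d_\rho^\theta=d_\rho^{\pi_\theta}$, and put $$\Theta=\{\theta: V_i^\theta\ge0,\ i=1,\dots,m\},\qquad B_\eta^\theta=V_0^\theta+\eta\sum_{i=1}^m\log V_i^\theta,$$ $$F^\theta=\mathbb E_{(s,a)\sim d_\rho^\theta}\big[\nabla_\theta\log\pi_\theta(a\mid s)\,\nabla_\theta\log\pi_\theta(a\mid s)^{T}\big],\qquad \mu_i^*=(F^\theta)^{\dagger}\,\nabla_\theta V_i^\theta ,$$ where $\dagger$ is the Moore--Penrose pseudoinverse. Suppose that $\|\nabla_\theta\log\pi_\theta(a\mid s)\|\le M_g$ for all $\theta\in\Theta$ and all $s,a$. Let $\eta>0$ and let $\theta\in\Theta$ satisfy $V_i^\theta>0$ for $i=1,\dots,m$.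 Let $\mu_F>0$ be a lower bound for all non-zero eigenvalues of $F^\theta$, and let $\varepsilon_{bias}$ be such that $$\mathbb E_{(s,a)\sim d_\rho^{\pi^*}}\Big[\big(A_i^\theta(s,a)-(1-\gamma)(\mu_i^*)^{T}\nabla_\theta\log\pi_\theta(a\mid s)\big)^2\Big]\le\varepsilon_{bias},\qquad i=0,\dots,m .$$ Then $V_0^\theta,\dots,V_m^\theta$ and $B_\eta^\theta$ are differentiable at $\theta$, and $$V_0^{\pi^*}(\rho)-V_0^\theta\ \le\ m\eta+\frac{\sqrt{\varepsilon_{bias}}}{1-\gamma}\Big(1+\sum_{i=1}^m\frac{\eta}{V_i^\theta}\Big)+\frac{M_g}{\mu_F}\,\big\|\nabla_\theta B_\eta^\theta\big\| .$$ -/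

import Mathlib

open MeasureTheory ProbabilityTheory

noncomputable section

/-- A discounted constrained Markov decision process on measurable state and action spaces, with
`m` constraints: transition kernel `P`, initial law `ρ`, reward `r 0` with values in `[0, 1]`,
utilities `r 1, …, r m` with values in `[-1, 1]`, and discount factor `γ ∈ (0, 1)`. -/
structure CMDP (S A : Type*) [MeasurableSpace S] [MeasurableSpace A] (m : ℕ) where
  P : Kernel (S × A) S
  isMarkovKernel_P : IsMarkovKernel P
  ρ : Measure S
  isProbabilityMeasure_ρ : IsProbabilityMeasure ρ
  r : Fin (m + 1) → S × A → ℝ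
  measurable_r : ∀ i, Measurable (r i)
  reward_mem : ∀ x, r 0 x ∈ Set.Icc (0 : ℝ) 1
  utility_mem : ∀ (i : Fin m) x, r i.succ x ∈ Set.Icc (-1 : ℝ) 1
  γ : ℝ
  γ_mem : γ ∈ Set.Ioo (0 : ℝ) 1

attribute [instance] CMDP.isMarkovKernel_P CMDP.isProbabilityMeasure_ρ

/-- A parameterized family of stationary stochastic policies `π_θ`, `θ ∈ ℝ^d`, given by positive
densities `π_θ(a|s)` with respect to a reference measure on the action space (the counting measure
for a discrete action space, Lebesgue measure for a continuous one), such that `log π_θ(a|s)` is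
differentiable in `θ`. -/
structure PolicyClass (S A : Type*) [MeasurableSpace S] [MeasurableSpace A] (d : ℕ) where
  ref : Measure A
  sigmaFinite_ref : SigmaFinite ref
  dens : EuclideanSpace ℝ (Fin d) → S → A → ℝ
  dens_pos : ∀ θ s a, 0 < dens θ s a
  measurable_dens : ∀ θ, Measurable (Function.uncurry (dens θ))
  lintegral_dens : ∀ θ s, ∫⁻ a, ENNReal.ofReal (dens θ s a) ∂ref = 1
  differentiable_log_dens : ∀ s a, Differentiable ℝ fun θ => Real.log (dens θ s a)

attribute [instance] PolicyClass.sigmaFinite_ref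

namespace PolicyClass

variable {S A : Type*} [MeasurableSpace S] [MeasurableSpace A] {d : ℕ}

/-- The policy `π_θ : S → Δ(A)`. -/
def policy (p : PolicyClass S A d) (θ : EuclideanSpace ℝ (Fin d)) : Kernel S A :=
  (Kernel.const S p.ref).withDensity fun s a => ENNReal.ofReal (p.dens θ s a)

theorem policy_apply (p : PolicyClass S A d) (θ : EuclideanSpace ℝ (Fin d)) (s : S) :
    p.policy θ s = p.ref.withDensity fun a => ENNReal.ofReal (p.dens θ s a) := by
  rw [policy, Kernel.withDensity_apply _ (p.measurable_dens θ).ennreal_ofReal, Kernel.const_apply]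

instance isMarkovKernel_policy (p : PolicyClass S A d) (θ : EuclideanSpace ℝ (Fin d)) :
    IsMarkovKernel (p.policy θ) := by
  refine ⟨fun s => ⟨?_⟩⟩
  rw [policy_apply, withDensity_apply _ MeasurableSet.univ, Measure.restrict_univ]
  exact p.lintegral_dens θ s

/-- The score `∇_θ log π_θ(a|s)`. -/
def score (p : PolicyClass S A d) (θ : EuclideanSpace ℝ (Fin d)) (x : S × A) :
    EuclideanSpace ℝ (Fin d) :=
  gradient (fun θ' => Real.log (p.dens θ' x.1 x.2)) θ

end PolicyClass

/-- The Moore–Penrose pseudoinverse of a symmetric real matrix: in an orthonormal eigenbasis it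
inverts the nonzero eigenvalues and keeps the zero ones. -/
def symmPinv {d : ℕ} (F : Matrix (Fin d) (Fin d) ℝ) : Matrix (Fin d) (Fin d) ℝ :=
  cfc (fun x : ℝ => x⁻¹) F

namespace CMDP

variable {S A : Type*} [MeasurableSpace S] [MeasurableSpace A] {m d : ℕ}

/-- One step of the state-action chain under the policy `π`:
`s' ~ P(·|s, a)` and then `a' ~ π(·|s')`. -/
def step (M : CMDP S A m) (π : Kernel S A) [IsMarkovKernel π] : Kernel (S × A) (S × A) :=
  M.P ⊗ₖ Kernel.prodMkLeft (S × A) π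

instance isMarkovKernel_step (M : CMDP S A m) (π : Kernel S A) [IsMarkovKernel π] :
    IsMarkovKernel (M.step π) := by
  unfold step; infer_instance

/-- The law of the trajectory `((s_0, a_0), (s_1, a_1), …)` under the policy `π` when
`(s_0, a_0)` has law `ν`. -/
def trajLaw (M : CMDP S A m) (π : Kernel S A) [IsMarkovKernel π] (ν : Measure (S × A)) :
    Measure (ℕ → S × A) :=
  Kernel.trajMeasure (X := fun _ => S × A) ν fun n =>
    (M.step π).comap (fun h : (i : Finset.Iic n) → S × A => h ⟨n, Finset.mem_Iic.2 le_rfl⟩)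
      (measurable_pi_apply _)

/-- The discounted return `∑_t γ^t r_i(s_t, a_t)` of a trajectory. -/
def discountedReturn (M : CMDP S A m) (i : Fin (m + 1)) (τ : ℕ → S × A) : ℝ :=
  ∑' t, M.γ ^ t * M.r i (τ t)

/-- The performance measure `V_i^π(ρ)`. -/
def value (M : CMDP S A m) (π : Kernel S A) [IsMarkovKernel π] (i : Fin (m + 1)) : ℝ :=
  ∫ τ, M.discountedReturn i τ ∂(M.trajLaw π (M.ρ ⊗ₘ π))

/-- The state value function `V_i^π(s)`. -/
def stateValue (M : CMDP S A m) (π : Kernel S A) [IsMarkovKernel π] (i : Fin (m + 1)) (s : S) :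
    ℝ :=
  ∫ τ, M.discountedReturn i τ ∂(M.trajLaw π (Measure.dirac s ⊗ₘ π))

/-- The state-action value function `Q_i^π(s, a)`. -/
def actionValue (M : CMDP S A m) (π : Kernel S A) [IsMarkovKernel π] (i : Fin (m + 1))
    (x : S × A) : ℝ :=
  ∫ τ, M.discountedReturn i τ ∂(M.trajLaw π (Measure.dirac x))

/-- The advantage function `A_i^π(s, a) = Q_i^π(s, a) - V_i^π(s)`. -/
def advantage (M : CMDP S A m) (π : Kernel S A) [IsMarkovKernel π] (i : Fin (m + 1))
    (x : S × A) : ℝ :=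
  M.actionValue π i x - M.stateValue π i x.1

/-- The discounted state-action visitation distribution
`d_ρ^π = (1 - γ) ∑_t γ^t Law(s_t, a_t)`. -/
def visitation (M : CMDP S A m) (π : Kernel S A) [IsMarkovKernel π] : Measure (S × A) :=
  Measure.sum fun t : ℕ =>
    ENNReal.ofReal ((1 - M.γ) * M.γ ^ t) • (M.trajLaw π (M.ρ ⊗ₘ π)).map fun τ => τ t

/-- `π` is an optimal stationary policy: it maximizes `V_0^π(ρ)` over all stationary stochastic
policies that satisfy the constraints `V_i^π(ρ) ≥ 0`, `i = 1, …, m`. -/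
def IsOptimalPolicy (M : CMDP S A m) (π : Kernel S A) [IsMarkovKernel π] : Prop :=
  (∀ i : Fin m, 0 ≤ M.value π i.succ) ∧
    ∀ (π' : Kernel S A) [IsMarkovKernel π'], (∀ i : Fin m, 0 ≤ M.value π' i.succ) →
      M.value π' 0 ≤ M.value π 0

/-- `V_i^θ(ρ)` as a function of `θ`. -/
def paramValue (M : CMDP S A m) (p : PolicyClass S A d) (i : Fin (m + 1))
    (θ : EuclideanSpace ℝ (Fin d)) : ℝ :=
  M.value (p.policy θ) i

/-- The feasible parameter set `Θ`. -/
def feasible (M : CMDP S A m) (p : PolicyClass S A d) : Set (EuclideanSpace ℝ (Fin d)) :=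
  {θ | ∀ i : Fin m, 0 ≤ M.paramValue p i.succ θ}

/-- The log barrier function `B_η^θ(ρ)`. -/
def logBarrier (M : CMDP S A m) (p : PolicyClass S A d) (η : ℝ)
    (θ : EuclideanSpace ℝ (Fin d)) : ℝ :=
  M.paramValue p 0 θ + η * ∑ i : Fin m, Real.log (M.paramValue p i.succ θ)

/-- The Fisher information matrix `F^θ(ρ)`. -/
def fisher (M : CMDP S A m) (p : PolicyClass S A d) (θ : EuclideanSpace ℝ (Fin d)) :
    Matrix (Fin d) (Fin d) ℝ :=
  Matrix.of fun j k => ∫ x, p.score θ x j * p.score θ x k ∂(M.visitation (p.policy θ))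

/-- `μ_i^* = F^θ(ρ)^† ∇_θ V_i^θ(ρ)`. -/
def naturalGradient (M : CMDP S A m) (p : PolicyClass S A d) (i : Fin (m + 1))
    (θ : EuclideanSpace ℝ (Fin d)) : EuclideanSpace ℝ (Fin d) :=
  Matrix.toEuclideanLin (symmPinv (M.fisher p θ)) (gradient (M.paramValue p i) θ)

/-- The transfer error `L(μ_i^*, θ, d_ρ^{π'})`. -/
def transferError (M : CMDP S A m) (p : PolicyClass S A d) (π' : Kernel S A) [IsMarkovKernel π']
    (i : Fin (m + 1)) (θ : EuclideanSpace ℝ (Fin d)) : ℝ :=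
  ∫ x, (M.advantage (p.policy θ) i x
      - (1 - M.γ) * inner ℝ (M.naturalGradient p i θ) (p.score θ x)) ^ 2 ∂(M.visitation π')

/-- The score is bounded by `Mg` on the feasible set. -/
def BoundedScore (M : CMDP S A m) (p : PolicyClass S A d) (Mg : ℝ) : Prop :=
  ∀ θ ∈ M.feasible p, ∀ x, ‖p.score θ x‖ ≤ Mg

/-- Every nonzero eigenvalue of the Fisher information matrix at `θ` is at least `μF`. -/
def RelaxedFisherNondegenerateAt (M : CMDP S A m) (p : PolicyClass S A d)
    (θ : EuclideanSpace ℝ (Fin d)) (μF : ℝ) : Prop :=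
  ∀ ev : ℝ, Module.End.HasEigenvalue (Matrix.toLin' (M.fisher p θ)) ev → ev ≠ 0 → μF ≤ ev

/-- The transfer errors of the reward and of all utilities at `θ` are at most `ε`. -/
def BoundedTransferErrorAt (M : CMDP S A m) (p : PolicyClass S A d) (πstar : Kernel S A)
    [IsMarkovKernel πstar] (θ : EuclideanSpace ℝ (Fin d)) (ε : ℝ) : Prop :=
  ∀ i, M.transferError p πstar i θ ≤ ε

end CMDP

end

/-!
By the performance difference lemma, `V_i^π' - V_i^π` is `(1 - γ)⁻¹` times the mean of `A_i^π` under
`d_ρ^π'`. Applied to `π' = π_θ` and `π = π_θ'`, it becomes, with the likelihood ratio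
`w = π_θ' / π_θ`,
`V_i^θ' - V_i^θ = (1 - γ)⁻¹ 𝔼_{d_ρ^θ} [(w - 1) Q_i^θ']`.
By Scheffé's lemma `w → 1` in `L¹(d_ρ^θ)` as `θ' → θ`, so `V_i^θ` and `Q_i^θ(s, a)` are continuous
in `θ`. Hence a strictly feasible parameter has a feasible neighbourhood, on which the score is
bounded, `w - 1` is `O(‖θ' - θ‖)` uniformly in `(s, a)`, and dominated convergence gives the policy
gradient theorem.

Applied to the comparator `π'` and `π = π_θ`, the lemma and the Cauchy–Schwarz inequality bound
`V_i^π' - V_i^θ` by `√ε_bias / (1 - γ) + ⟪μ_i^*, g⟫`, where `g` is the mean score under `d_ρ^π'`, so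
that `‖g‖ ≤ M_g`. Adding these bounds with the multipliers `1` for `i = 0` and `η / V_i^θ` for
`i ≥ 1` turns the vectors `μ_i^*` into `(F^θ)^† ∇ B_η^θ`, and the constraints `V_i^π' ≥ 0` make the
left-hand side at least `V_0^π' - V_0^θ - m η`.
-/

open Filter Topology

/-! ### Discounted occupation of a Markov chain -/

theorem integral_measureComp {X Y E : Type*} [MeasurableSpace X] [MeasurableSpace Y]
    [NormedAddCommGroup E] [NormedSpace ℝ E] {κ : Kernel X Y} {μ : Measure X} {f : Y → E}
    (hf : Integrable f (κ ∘ₘ μ)) :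
    ∫ y, f y ∂(κ ∘ₘ μ) = ∫ x, ∫ y, f y ∂(κ x) ∂μ := by
  rw [Measure.comp_eq_comp_const_apply] at hf ⊢
  rw [Kernel.integral_comp hf, Kernel.const_apply]

theorem integral_ofReal_smul_add_ofReal_smul {X : Type*} [MeasurableSpace X] {μ ν : Measure X}
    {f : X → ℝ} {a b : ℝ} (ha : 0 ≤ a) (hb : 0 ≤ b) (hμ : Integrable f μ) (hν : Integrable f ν) :
    ∫ x, f x ∂(ENNReal.ofReal a • μ + ENNReal.ofReal b • ν) =
      a * ∫ x, f x ∂μ + b * ∫ x, f x ∂ν := by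
  rw [integral_add_measure (hμ.smul_measure ENNReal.ofReal_ne_top)
    (hν.smul_measure ENNReal.ofReal_ne_top), integral_smul_measure, integral_smul_measure,
    ENNReal.toReal_ofReal ha, ENNReal.toReal_ofReal hb, smul_eq_mul, smul_eq_mul]

section WeightedMap

variable {Ω X : Type*} [MeasurableSpace Ω] [MeasurableSpace X] {μ : Measure Ω} {φ : Ω → X}
  {f : X → ℝ} {c : ℝ}

theorem integrable_mul_comp_of_ofReal_smul_map (hc : 0 ≤ c) (hφ : AEMeasurable φ μ)
    (hf : Integrable f (ENNReal.ofReal c • μ.map φ)) : Integrable (fun ω => c * f (φ ω)) μ := by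
  rcases hc.eq_or_lt with rfl | hc
  · simp
  · rw [integrable_smul_measure (by simpa using hc) ENNReal.ofReal_ne_top] at hf
    exact (hf.comp_aemeasurable hφ).const_mul c

theorem integral_ofReal_smul_map (hc : 0 ≤ c) (hφ : AEMeasurable φ μ)
    (hf : Integrable f (ENNReal.ofReal c • μ.map φ)) :
    ∫ x, f x ∂(ENNReal.ofReal c • μ.map φ) = ∫ ω, c * f (φ ω) ∂μ := by
  rcases hc.eq_or_lt with rfl | hc
  · simp
  · rw [integrable_smul_measure (by simpa using hc) ENNReal.ofReal_ne_top] at hf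
    rw [integral_smul_measure, integral_map hφ hf.aestronglyMeasurable, integral_const_mul,
      ENNReal.toReal_ofReal hc.le, smul_eq_mul]

end WeightedMap

section MarkovChain

variable {X : Type*} [MeasurableSpace X] (κ : Kernel X X)

/-- The law of the trajectory of the time-homogeneous Markov chain with transition kernel `κ` and
initial law `ν`. -/
noncomputable def markovChainLaw [IsMarkovKernel κ] (ν : Measure X) : Measure (ℕ → X) :=
  Kernel.trajMeasure (X := fun _ => X) ν fun n =>
    κ.comap (fun h : (i : Finset.Iic n) → X => h ⟨n, Finset.mem_Iic.2 le_rfl⟩)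
      (measurable_pi_apply _)

section Law

variable [IsMarkovKernel κ] (ν : Measure X)

instance isProbabilityMeasure_markovChainLaw [IsProbabilityMeasure ν] :
    IsProbabilityMeasure (markovChainLaw κ ν) := by
  unfold markovChainLaw; infer_instance

theorem map_markovChainLaw_zero : (markovChainLaw κ ν).map (fun τ => τ 0) = ν := by
  have h : (fun τ : ℕ → X => τ 0) = MeasurableEquiv.piUnique (fun _ : Finset.Iic 0 => X) ∘
      Preorder.frestrictLe (π := fun _ => X) 0 := rfl
  rw [h, ← Measure.map_map (MeasurableEquiv.measurable _) (by fun_prop), markovChainLaw,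
    Kernel.trajMeasure, Measure.map_comp _ _ (by fun_prop), Kernel.traj_map_frestrictLe,
    Kernel.partialTraj_self, Measure.id_comp]
  exact MeasurableEquiv.map_map_symm _

theorem map_markovChainLaw_succ [IsProbabilityMeasure ν] (t : ℕ) :
    (markovChainLaw κ ν).map (fun τ => τ (t + 1)) =
      κ ∘ₘ (markovChainLaw κ ν).map (fun τ => τ t) := by
  have h := congrArg Measure.snd <|
    Kernel.map_frestrictLe_trajMeasure_compProd_eq_map_trajMeasure (X := fun _ => X) (μ₀ := ν)
      (κ := fun n => κ.comap (fun h : (i : Finset.Iic n) → X => h ⟨n, Finset.mem_Iic.2 le_rfl⟩)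
        (measurable_pi_apply _)) (a := t)
  rw [Measure.snd_compProd, Measure.snd_map_prodMk (by fun_prop)] at h
  rw [markovChainLaw, ← h, ← Kernel.comp_deterministic_eq_comap, ← Measure.comp_assoc,
    Measure.deterministic_comp_eq_map, Measure.map_map (by fun_prop) (by fun_prop)]
  rfl

theorem map_markovChainLaw [IsProbabilityMeasure ν] (t : ℕ) :
    (markovChainLaw κ ν).map (fun τ => τ t) = (κ ^ t) ∘ₘ ν := by
  induction t with
  | zero => rw [map_markovChainLaw_zero, pow_zero]; exact Measure.id_comp.symm
  | succ t ih => rw [map_markovChainLaw_succ, ih, Measure.comp_assoc, pow_succ']; rfl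

end Law

instance isMarkovKernel_pow [IsMarkovKernel κ] (t : ℕ) : IsMarkovKernel (κ ^ t) := by
  induction t with
  | zero => rw [pow_zero]; exact inferInstanceAs (IsMarkovKernel Kernel.id)
  | succ t ih => rw [pow_succ]; exact inferInstanceAs (IsMarkovKernel ((κ ^ t) ∘ₖ κ))

/-- The normalized discounted occupation kernel `(1 - γ) ∑ₜ γᵗ κᵗ` of the Markov chain with
transition kernel `κ`. -/
noncomputable def discountedOccupation (γ : ℝ) : Kernel X X where
  toFun x := Measure.sum fun t : ℕ => ENNReal.ofReal ((1 - γ) * γ ^ t) • (κ ^ t) x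
  measurable' := by
    refine Measure.measurable_of_measurable_coe _ fun s hs => ?_
    simp only [Measure.sum_apply _ hs, Measure.smul_apply, smul_eq_mul]
    exact .tsum fun t => ((κ ^ t).measurable_coe hs).const_mul _

variable (γ : ℝ)

theorem discountedOccupation_apply (x : X) :
    discountedOccupation κ γ x =
      Measure.sum fun t : ℕ => ENNReal.ofReal ((1 - γ) * γ ^ t) • (κ ^ t) x := rfl

theorem discountedOccupation_measureComp (ν : Measure X) :
    discountedOccupation κ γ ∘ₘ ν =
      Measure.sum fun t : ℕ => ENNReal.ofReal ((1 - γ) * γ ^ t) • ((κ ^ t) ∘ₘ ν) := by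
  ext s hs
  simp only [Measure.bind_apply hs (Kernel.aemeasurable _), discountedOccupation_apply,
    Measure.sum_apply _ hs, Measure.smul_apply, smul_eq_mul]
  rw [lintegral_tsum fun t => (((κ ^ t).measurable_coe hs).const_mul _).aemeasurable]
  simp_rw [lintegral_const_mul _ (Kernel.measurable_coe _ hs)]

theorem comp_discountedOccupation :
    κ ∘ₖ discountedOccupation κ γ = discountedOccupation κ γ ∘ₖ κ := by
  ext x s hs
  rw [Kernel.comp_apply, Kernel.comp_apply, discountedOccupation_measureComp,
    Measure.bind_apply hs (Kernel.aemeasurable _), discountedOccupation_apply,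
    lintegral_sum_measure, Measure.sum_apply _ hs]
  refine tsum_congr fun t => ?_
  rw [lintegral_smul_measure, Measure.smul_apply, ← Measure.bind_apply hs (Kernel.aemeasurable _),
    ← Kernel.comp_apply, ← Kernel.comp_apply]
  exact congrArg (fun η : Kernel X X => _ • η x s) ((pow_succ' κ t).symm.trans (pow_succ κ t))

variable {γ} (hγ₀ : 0 ≤ γ)
include hγ₀

theorem discountedOccupation_measureComp_eq_add (ν : Measure X) :
    discountedOccupation κ γ ∘ₘ ν = ENNReal.ofReal (1 - γ) • ν +
      ENNReal.ofReal γ • (discountedOccupation κ γ ∘ₘ (κ ∘ₘ ν)) := by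
  ext s hs
  simp only [discountedOccupation_measureComp, Measure.add_apply, Measure.smul_apply, smul_eq_mul,
    Measure.sum_apply _ hs]
  rw [tsum_eq_zero_add' ENNReal.summable, ← ENNReal.tsum_mul_left, pow_zero, pow_zero, mul_one]
  congr 1
  · exact congrArg (fun μ : Measure X => _ * μ s) Measure.id_comp
  · refine tsum_congr fun t => ?_
    rw [← mul_assoc, ← ENNReal.ofReal_mul hγ₀, Measure.comp_assoc, pow_succ κ, pow_succ' γ,
      mul_left_comm]
    rfl

theorem discountedOccupation_measureComp_eq_add' (ν : Measure X) :
    discountedOccupation κ γ ∘ₘ ν = ENNReal.ofReal (1 - γ) • ν +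
      ENNReal.ofReal γ • (κ ∘ₘ (discountedOccupation κ γ ∘ₘ ν)) := by
  rw [Measure.comp_assoc (η := κ), comp_discountedOccupation, ← Measure.comp_assoc]
  exact discountedOccupation_measureComp_eq_add κ hγ₀ ν

variable (hγ₁ : γ < 1) [IsMarkovKernel κ]
include hγ₁

theorem isMarkovKernel_discountedOccupation : IsMarkovKernel (discountedOccupation κ γ) := by
  refine ⟨fun x => ⟨?_⟩⟩
  have hsum : HasSum (fun t : ℕ => (1 - γ) * γ ^ t) 1 := by
    simpa [(sub_pos.2 hγ₁).ne'] using (hasSum_geometric_of_lt_one hγ₀ hγ₁).mul_left (1 - γ)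
  simp only [discountedOccupation_apply, Measure.sum_apply _ MeasurableSet.univ,
    Measure.smul_apply, measure_univ, smul_eq_mul, mul_one]
  rw [← ENNReal.ofReal_tsum_of_nonneg _ hsum.summable, hsum.tsum_eq, ENNReal.ofReal_one]
  exact fun t => mul_nonneg (sub_pos.2 hγ₁).le (pow_nonneg hγ₀ t)

theorem integral_tsum_markovChainLaw (ν : Measure X) [IsProbabilityMeasure ν] {f : X → ℝ}
    (hf : Integrable f (discountedOccupation κ γ ∘ₘ ν)) :
    ∫ τ, ∑' t, γ ^ t * f (τ t) ∂(markovChainLaw κ ν) =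
      (1 - γ)⁻¹ * ∫ x, f x ∂(discountedOccupation κ γ ∘ₘ ν) := by
  have hγ : 0 < 1 - γ := sub_pos.2 hγ₁
  have hweight (t : ℕ) : 0 ≤ (1 - γ) * γ ^ t := mul_nonneg hγ.le (pow_nonneg hγ₀ t)
  have hτ (t : ℕ) : AEMeasurable (fun τ : ℕ → X => τ t) (markovChainLaw κ ν) :=
    (measurable_pi_apply t).aemeasurable
  simp only [discountedOccupation_measureComp, ← map_markovChainLaw] at hf ⊢
  have hterm (t : ℕ) := hf.mono_measure (Measure.le_sum _ t)
  have hsum := hasSum_integral_measure hf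
  have hsummable := (hasSum_integral_measure hf.norm).summable
  simp only [integral_ofReal_smul_map (hweight _) (hτ _) (hterm _)] at hsum
  simp only [integral_ofReal_smul_map (hweight _) (hτ _) (hterm _).norm] at hsummable
  rw [eq_inv_mul_iff_mul_eq₀ hγ.ne', ← integral_const_mul, ← hsum.tsum_eq,
    integral_tsum_of_summable_integral_norm
      (fun t => integrable_mul_comp_of_ofReal_smul_map (hweight t) (hτ t) (hterm t))]
  · simp_rw [← tsum_mul_left, mul_assoc]
  · simpa only [norm_mul, Real.norm_of_nonneg (hweight _), ← mul_assoc] using hsummable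

end MarkovChain

/-! ### Analysis -/

theorem tendsto_integral_abs_sub_of_tendsto_integral {α ι : Type*} [MeasurableSpace α]
    {μ : Measure α} {l : Filter ι} [l.IsCountablyGenerated] {f : ι → α → ℝ} {g : α → ℝ}
    (hf : ∀ i, Integrable (f i) μ) (hf₀ : ∀ i, 0 ≤ᵐ[μ] f i) (hg : Integrable g μ)
    (hlim : ∀ᵐ x ∂μ, Tendsto (fun i => f i x) l (𝓝 (g x)))
    (hint : Tendsto (fun i => ∫ x, f i x ∂μ) l (𝓝 (∫ x, g x ∂μ))) :
    Tendsto (fun i => ∫ x, |f i x - g x| ∂μ) l (𝓝 0) := by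
  have hpos (i : ι) : Integrable (fun x => max (g x - f i x) 0) μ := (hg.sub (hf i)).pos_part
  have hdom : Tendsto (fun i => ∫ x, max (g x - f i x) 0 ∂μ) l (𝓝 (∫ _, (0 : ℝ) ∂μ)) := by
    refine tendsto_integral_filter_of_dominated_convergence (fun x => |g x|)
      (.of_forall fun i => (hpos i).aestronglyMeasurable) (.of_forall fun i => ?_) hg.abs ?_
    · filter_upwards [hf₀ i] with x hx
      rw [Real.norm_of_nonneg (le_max_right _ _)]
      exact max_le (by linarith [le_abs_self (g x), show 0 ≤ f i x from hx]) (abs_nonneg _)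
    · filter_upwards [hlim] with x hx
      simpa using (hx.const_sub (g x)).max (tendsto_const_nhds (x := (0 : ℝ)))
  have hsplit (i : ι) : ∫ x, |f i x - g x| ∂μ =
      ∫ x, f i x ∂μ - ∫ x, g x ∂μ + 2 * ∫ x, max (g x - f i x) 0 ∂μ := by
    rw [← integral_sub (hf i) hg, ← integral_const_mul,
      ← integral_add (f := fun x => f i x - g x) ((hf i).sub hg) ((hpos i).const_mul 2)]
    refine integral_congr_ae (.of_forall fun x => ?_)
    rcases le_total (f i x) (g x) with h | h
    · simp only [abs_of_nonpos (sub_nonpos.2 h), max_eq_left (sub_nonneg.2 h)]; ring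
    · simp [abs_of_nonneg (sub_nonneg.2 h), max_eq_right (sub_nonpos.2 h)]
  simpa [hsplit] using (hint.sub_const (∫ x, g x ∂μ)).add (hdom.const_mul 2)

theorem integral_le_sqrt_integral_sq {X : Type*} [MeasurableSpace X] {μ : Measure X}
    [IsProbabilityMeasure μ] {f : X → ℝ} (hf : MemLp f 2 μ) :
    ∫ x, f x ∂μ ≤ √(∫ x, f x ^ 2 ∂μ) := by
  have hvar := variance_nonneg f μ
  rw [variance_eq_sub hf, sub_nonneg] at hvar
  exact Real.le_sqrt_of_sq_le hvar

theorem hasFDerivAt_smul_of_eq_zero {𝕜 E F : Type*} [NontriviallyNormedField 𝕜]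
    [NormedAddCommGroup E] [NormedSpace 𝕜 E] [NormedAddCommGroup F] [NormedSpace 𝕜 F]
    {c : E → 𝕜} {c' : E →L[𝕜] 𝕜} {f : E → F} {x : E} (hc : HasFDerivAt c c' x) (hcx : c x = 0)
    (hf : ContinuousAt f x) : HasFDerivAt (fun y => c y • f y) (c'.smulRight (f x)) x := by
  have hprod : (fun y => c y • (f y - f x)) =o[𝓝 x] fun y => y - x := by
    have hfx : (fun y => f y - f x) =o[𝓝 x] fun _ => (1 : ℝ) :=
      (Asymptotics.isLittleO_one_iff ℝ).2 (tendsto_sub_nhds_zero_iff.2 hf)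
    simpa [hcx] using hc.isBigO_sub.norm_right.smul_isLittleO hfx
  have hrem : HasFDerivAt (fun y => c y • (f y - f x)) (0 : E →L[𝕜] F) x :=
    .of_isLittleO (by simpa [hcx] using hprod)
  simpa [smul_sub, Pi.add_def] using hrem.add (hc.smul_const (f x))

theorem hasGradientAt_integral_of_dominated_loc_of_lip {X E : Type*} [MeasurableSpace X]
    [NormedAddCommGroup E] [InnerProductSpace ℝ E] [CompleteSpace E] {μ : Measure X}
    {f : E → X → ℝ} {g : X → E} {y : E} {bound : X → ℝ} {U : Set E} (hU : U ∈ 𝓝 y)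
    (hf : ∀ z ∈ U, AEStronglyMeasurable (f z) μ) (hfy : Integrable (f y) μ)
    (hg : AEStronglyMeasurable g μ)
    (hlip : ∀ᵐ x ∂μ, ∀ z ∈ U, |f z x - f y x| ≤ bound x * ‖z - y‖) (hbound : Integrable bound μ)
    (hgrad : ∀ᵐ x ∂μ, HasGradientAt (f · x) (g x) y) :
    HasGradientAt (fun z => ∫ x, f z x ∂μ) (∫ x, g x ∂μ) y := by
  obtain ⟨hint, hderiv⟩ := hasFDerivAt_integral_of_dominated_loc_of_lip' hU hf hfy
    ((InnerProductSpace.toDual ℝ E).continuous.comp_aestronglyMeasurable hg) hlip hbound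
    (hgrad.mono fun _ hx => hx.hasFDerivAt)
  have hgint : Integrable g μ :=
    hint.mono hg (.of_forall fun x => (LinearIsometryEquiv.norm_map _ _).ge)
  refine hderiv.congr_fderiv (ContinuousLinearMap.ext fun v => ?_)
  rw [ContinuousLinearMap.integral_apply hint, InnerProductSpace.toDual_apply_apply,
    real_inner_comm, ← integral_inner hgint]
  simp_rw [InnerProductSpace.toDual_apply_apply, real_inner_comm]

theorem measurable_gradient_of_differentiableAt {X E : Type*} [MeasurableSpace X]
    [NormedAddCommGroup E] [InnerProductSpace ℝ E] [FiniteDimensional ℝ E] [MeasurableSpace E]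
    [BorelSpace E] {f : E → X → ℝ} {y : E} (hf : ∀ z, Measurable (f z))
    (hfy : ∀ x, DifferentiableAt ℝ (fun z => f z x) y) :
    Measurable fun x => gradient (fun z => f z x) y := by
  have hinner (v : E) : Measurable fun x => inner ℝ v (gradient (fun z => f z x) y) := by
    refine measurable_of_tendsto_metrizable (f := fun (n : ℕ) (x : X) =>
      (n : ℝ) • (f (y + (n : ℝ)⁻¹ • v) x - f y x))
      (fun n => ((hf _).sub (hf y)).const_mul _) (tendsto_pi_nhds.2 fun x => ?_)
    have h := (hfy x).hasGradientAt.hasFDerivAt.lim v (c := fun n : ℕ => (n : ℝ)) (l := atTop)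
      (tendsto_norm_atTop_atTop.comp tendsto_natCast_atTop_atTop)
    simpa [real_inner_comm] using h
  have hrepr (x : X) := (stdOrthonormalBasis ℝ E).sum_repr' (gradient (fun z => f z x) y)
  rw [← funext hrepr]
  exact Finset.measurable_sum _ fun j _ => (hinner _).smul_const _

theorem hasGradientAt_add_const_mul_sum_log {E ι : Type*} [NormedAddCommGroup E]
    [InnerProductSpace ℝ E] [CompleteSpace E] [Fintype ι] {f₀ : E → ℝ} {f : ι → E → ℝ} {g₀ : E}
    {g : ι → E} {x : E} (η : ℝ) (h₀ : HasGradientAt f₀ g₀ x)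
    (h : ∀ i, HasGradientAt (f i) (g i) x) (hx : ∀ i, f i x ≠ 0) :
    HasGradientAt (fun y => f₀ y + η * ∑ i, Real.log (f i y))
      (g₀ + ∑ i, (η / f i x) • g i) x := by
  have hlog := HasFDerivAt.fun_sum (u := Finset.univ) fun i _ => (h i).hasFDerivAt.log (hx i)
  refine (h₀.hasFDerivAt.add (hlog.const_mul η)).congr_fderiv ?_
  simp only [map_add, map_sum, map_smul, Finset.smul_sum, smul_smul, div_eq_mul_inv]

open scoped Matrix.Norms.L2Operator in
theorem norm_toEuclideanLin_symmPinv_le {d : ℕ} {F : Matrix (Fin d) (Fin d) ℝ} {c : ℝ}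
    (hc : 0 < c)
    (hF : ∀ ev : ℝ, Module.End.HasEigenvalue (Matrix.toLin' F) ev → ev ≠ 0 → c ≤ ev)
    (v : EuclideanSpace ℝ (Fin d)) :
    ‖Matrix.toEuclideanLin (symmPinv F) v‖ ≤ c⁻¹ * ‖v‖ := by
  have hspec (x : ℝ) (hx : x ∈ spectrum ℝ F) : ‖x⁻¹‖ ≤ c⁻¹ := by
    rcases eq_or_ne x 0 with rfl | hx₀
    · simpa using hc.le
    have hcx : c ≤ x := hF x
      (by rwa [Module.End.hasEigenvalue_iff_mem_spectrum, Matrix.spectrum_toLin']) hx₀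
    rw [norm_inv, Real.norm_of_nonneg (hc.le.trans hcx)]
    exact inv_anti₀ hc hcx
  exact (Matrix.l2_opNorm_mulVec (symmPinv F) v).trans
    (mul_le_mul_of_nonneg_right (norm_cfc_le (inv_nonneg.2 hc.le) hspec) (norm_nonneg v))

theorem sub_le_of_barrier_multipliers {ι : Type*} [Fintype ι] {η e v₀ v₀' z₀ : ℝ}
    {v v' z : ι → ℝ} (hη : 0 ≤ η) (hv : ∀ i, 0 < v i) (hv' : ∀ i, 0 ≤ v' i)
    (h₀ : v₀' - v₀ ≤ e + z₀) (h : ∀ i, v' i - v i ≤ e + z i) :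
    v₀' - v₀ ≤ Fintype.card ι * η + e * (1 + ∑ i, η / v i) + (z₀ + ∑ i, η / v i * z i) := by
  have hterm (i : ι) : 0 ≤ η + e * (η / v i) + η / v i * z i :=
    calc 0 ≤ η / v i * v' i := mul_nonneg (div_nonneg hη (hv i).le) (hv' i)
      _ = η + η / v i * (v' i - v i) := by rw [mul_sub, div_mul_cancel₀ _ (hv i).ne']; ring
      _ ≤ η + η / v i * (e + z i) := by gcongr; exacts [div_nonneg hη (hv i).le, h i]
      _ = η + e * (η / v i) + η / v i * z i := by ring
  have hsum := Finset.sum_nonneg fun i (_ : i ∈ Finset.univ) => hterm i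
  simp only [Finset.sum_add_distrib, Finset.sum_const, Finset.card_univ, nsmul_eq_mul,
    ← Finset.mul_sum] at hsum
  linarith

/-! ### Values, visitation and the performance difference lemma -/

namespace CMDP

section Values

variable {S A : Type*} [MeasurableSpace S] [MeasurableSpace A] {m : ℕ} (M : CMDP S A m)

theorem γ_nonneg : 0 ≤ M.γ := M.γ_mem.1.le

theorem one_sub_γ_pos : 0 < 1 - M.γ := sub_pos.2 M.γ_mem.2

theorem inv_one_sub_γ_nonneg : 0 ≤ (1 - M.γ)⁻¹ := inv_nonneg.2 M.one_sub_γ_pos.le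

theorem norm_r_le_one (i : Fin (m + 1)) (x : S × A) : ‖M.r i x‖ ≤ 1 :=
  abs_le.2 <| Fin.cases ⟨by linarith [(M.reward_mem x).1], (M.reward_mem x).2⟩
    (fun j => M.utility_mem j x) i

theorem integrable_r (i : Fin (m + 1)) (μ : Measure (S × A)) [IsFiniteMeasure μ] :
    Integrable (M.r i) μ :=
  .of_bound (M.measurable_r i).aestronglyMeasurable 1 (.of_forall (M.norm_r_le_one i))

variable (π : Kernel S A) [IsMarkovKernel π]

theorem step_measureComp (ν : Measure (S × A)) [SFinite ν] :
    M.step π ∘ₘ ν = (M.P ∘ₘ ν) ⊗ₘ π := by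
  rw [step, Kernel.compProd_prodMkLeft_eq_comp, ← Measure.comp_assoc,
    ← Measure.compProd_eq_comp_prod]

/-- The normalized discounted occupation kernel of the state-action chain under `π`: its value at
`x` is the discounted state-action visitation distribution of the chain started from `x`. -/
noncomputable def occupation : Kernel (S × A) (S × A) :=
  discountedOccupation (M.step π) M.γ

instance isMarkovKernel_occupation : IsMarkovKernel (M.occupation π) :=
  isMarkovKernel_discountedOccupation _ M.γ_nonneg M.γ_mem.2

theorem visitation_eq_occupation : M.visitation π = M.occupation π ∘ₘ (M.ρ ⊗ₘ π) := by
  rw [occupation, discountedOccupation_measureComp]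
  simp_rw [← map_markovChainLaw]
  rfl

instance isProbabilityMeasure_visitation : IsProbabilityMeasure (M.visitation π) := by
  rw [visitation_eq_occupation]; infer_instance

theorem integral_discountedReturn (i : Fin (m + 1)) (ν : Measure (S × A))
    [IsProbabilityMeasure ν] :
    ∫ τ, M.discountedReturn i τ ∂(M.trajLaw π ν) =
      (1 - M.γ)⁻¹ * ∫ x, M.r i x ∂(M.occupation π ∘ₘ ν) :=
  integral_tsum_markovChainLaw (M.step π) M.γ_nonneg M.γ_mem.2 ν
    (M.integrable_r i (M.occupation π ∘ₘ ν))

theorem actionValue_eq_integral (i : Fin (m + 1)) (x : S × A) :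
    M.actionValue π i x = (1 - M.γ)⁻¹ * ∫ y, M.r i y ∂(M.occupation π x) := by
  rw [actionValue, integral_discountedReturn, Measure.dirac_bind (Kernel.measurable _)]

theorem integral_actionValue (i : Fin (m + 1)) (ν : Measure (S × A)) [IsProbabilityMeasure ν] :
    ∫ x, M.actionValue π i x ∂ν = ∫ τ, M.discountedReturn i τ ∂(M.trajLaw π ν) := by
  simp_rw [actionValue_eq_integral]
  rw [integral_const_mul, ← integral_measureComp (M.integrable_r i _), integral_discountedReturn]

theorem measurable_actionValue (i : Fin (m + 1)) : Measurable (M.actionValue π i) := by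
  simp_rw [funext (M.actionValue_eq_integral π i)]
  exact (M.measurable_r i).stronglyMeasurable.integral_kernel.measurable.const_mul _

theorem norm_actionValue_le (i : Fin (m + 1)) (x : S × A) :
    ‖M.actionValue π i x‖ ≤ (1 - M.γ)⁻¹ := by
  rw [actionValue_eq_integral, norm_mul, Real.norm_of_nonneg M.inv_one_sub_γ_nonneg]
  refine mul_le_of_le_one_right M.inv_one_sub_γ_nonneg ?_
  simpa using norm_integral_le_of_norm_le_const (μ := M.occupation π x)
    (.of_forall (M.norm_r_le_one i))

theorem integrable_actionValue (i : Fin (m + 1)) (μ : Measure (S × A)) [IsFiniteMeasure μ] :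
    Integrable (M.actionValue π i) μ :=
  .of_bound (M.measurable_actionValue π i).aestronglyMeasurable _
    (.of_forall (M.norm_actionValue_le π i))

theorem stateValue_eq_integral (i : Fin (m + 1)) (s : S) :
    M.stateValue π i s = ∫ a, M.actionValue π i (s, a) ∂(π s) := by
  rw [stateValue, ← integral_actionValue,
    Measure.integral_compProd (M.integrable_actionValue π i _), integral_dirac']
  exact (M.measurable_actionValue π i).stronglyMeasurable.integral_kernel_prod_right'

theorem measurable_stateValue (i : Fin (m + 1)) : Measurable (M.stateValue π i) := by
  simp_rw [funext (M.stateValue_eq_integral π i)]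
  exact (M.measurable_actionValue π i).stronglyMeasurable.integral_kernel_prod_right'.measurable

theorem norm_stateValue_le (i : Fin (m + 1)) (s : S) : ‖M.stateValue π i s‖ ≤ (1 - M.γ)⁻¹ := by
  rw [stateValue_eq_integral]
  simpa using norm_integral_le_of_norm_le_const (μ := π s)
    (.of_forall fun a => M.norm_actionValue_le π i (s, a))

theorem integrable_stateValue (i : Fin (m + 1)) (μ : Measure S) [IsFiniteMeasure μ] :
    Integrable (M.stateValue π i) μ :=
  .of_bound (M.measurable_stateValue π i).aestronglyMeasurable _
    (.of_forall (M.norm_stateValue_le π i))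

theorem integral_stateValue (i : Fin (m + 1)) (μ : Measure S) [IsProbabilityMeasure μ] :
    ∫ s, M.stateValue π i s ∂μ = ∫ x, M.actionValue π i x ∂(μ ⊗ₘ π) := by
  simp_rw [stateValue_eq_integral]
  rw [Measure.integral_compProd (M.integrable_actionValue π i _)]

theorem value_eq_integral_stateValue (i : Fin (m + 1)) :
    M.value π i = ∫ s, M.stateValue π i s ∂M.ρ := by
  rw [integral_stateValue, integral_actionValue, value]

theorem value_eq_integral_visitation (i : Fin (m + 1)) :
    M.value π i = (1 - M.γ)⁻¹ * ∫ x, M.r i x ∂(M.visitation π) := by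
  rw [value, integral_discountedReturn, visitation_eq_occupation]

theorem occupation_eq_add (x : S × A) :
    M.occupation π x = ENNReal.ofReal (1 - M.γ) • Measure.dirac x +
      ENNReal.ofReal M.γ • (M.occupation π ∘ₘ (M.P x ⊗ₘ π)) := by
  have h := discountedOccupation_measureComp_eq_add (M.step π) M.γ_nonneg (.dirac x)
  rwa [step_measureComp, Measure.dirac_bind (Kernel.measurable _),
    Measure.dirac_bind (Kernel.measurable _)] at h

theorem actionValue_eq_add_integral_stateValue (i : Fin (m + 1)) (x : S × A) :
    M.actionValue π i x = M.r i x + M.γ * ∫ s, M.stateValue π i s ∂(M.P x) := by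
  rw [integral_stateValue, integral_actionValue, integral_discountedReturn,
    actionValue_eq_integral, occupation_eq_add, integral_ofReal_smul_add_ofReal_smul
      M.one_sub_γ_pos.le M.γ_nonneg (M.integrable_r i _) (M.integrable_r i _),
    integral_dirac' _ _ (M.measurable_r i).stronglyMeasurable, mul_add,
    inv_mul_cancel_left₀ M.one_sub_γ_pos.ne', mul_left_comm]

/-- The same decision process, started from the initial state law `μ`. -/
def withInitialLaw (μ : Measure S) [IsProbabilityMeasure μ] : CMDP S A m :=
  { M with ρ := μ, isProbabilityMeasure_ρ := inferInstance }

theorem actionValue_eq_add_value (i : Fin (m + 1)) (x : S × A) :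
    M.actionValue π i x = M.r i x + M.γ * (M.withInitialLaw (M.P x)).value π i := by
  rw [actionValue_eq_add_integral_stateValue, value_eq_integral_stateValue]
  rfl

/-- The discounted state visitation distribution. -/
noncomputable def stateVisitation : Measure S := (M.visitation π).fst

instance isProbabilityMeasure_stateVisitation : IsProbabilityMeasure (M.stateVisitation π) := by
  unfold stateVisitation; infer_instance

theorem visitation_eq_add_compProd :
    M.visitation π = (ENNReal.ofReal (1 - M.γ) • M.ρ +
      ENNReal.ofReal M.γ • (M.P ∘ₘ M.visitation π)) ⊗ₘ π := by
  have hflow := discountedOccupation_measureComp_eq_add' (M.step π) M.γ_nonneg (M.ρ ⊗ₘ π)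
  rw [← occupation, ← visitation_eq_occupation, step_measureComp] at hflow
  rwa [Measure.compProd_add_left, Measure.compProd_smul_left, Measure.compProd_smul_left]

theorem stateVisitation_eq_add :
    M.stateVisitation π =
      ENNReal.ofReal (1 - M.γ) • M.ρ + ENNReal.ofReal M.γ • (M.P ∘ₘ M.visitation π) := by
  rw [stateVisitation, visitation_eq_add_compProd, Measure.fst_compProd,
    ← visitation_eq_add_compProd]

theorem visitation_eq_compProd : M.visitation π = M.stateVisitation π ⊗ₘ π := by
  rw [stateVisitation_eq_add, ← visitation_eq_add_compProd]

theorem integral_fst_visitation {f : S → ℝ} (hf : Measurable f) :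
    ∫ x, f x.1 ∂(M.visitation π) = ∫ s, f s ∂(M.stateVisitation π) :=
  (integral_map measurable_fst.aemeasurable hf.aestronglyMeasurable).symm

theorem measurable_advantage (i : Fin (m + 1)) : Measurable (M.advantage π i) :=
  (M.measurable_actionValue π i).sub ((M.measurable_stateValue π i).comp measurable_fst)

theorem norm_advantage_le (i : Fin (m + 1)) (x : S × A) :
    ‖M.advantage π i x‖ ≤ (1 - M.γ)⁻¹ + (1 - M.γ)⁻¹ :=
  norm_sub_le_of_le (M.norm_actionValue_le π i x) (M.norm_stateValue_le π i x.1)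

theorem integral_advantage_visitation (π' : Kernel S A) [IsMarkovKernel π'] (i : Fin (m + 1)) :
    ∫ x, M.advantage π i x ∂(M.visitation π') =
      ∫ x, M.actionValue π i x ∂(M.visitation π') -
        ∫ s, M.stateValue π i s ∂(M.stateVisitation π') := by
  rw [← integral_fst_visitation _ _ (M.measurable_stateValue π i)]
  exact integral_sub (M.integrable_actionValue π i _)
    ((M.integrable_stateValue π i (M.stateVisitation π')).comp_measurable measurable_fst)

theorem integral_stateValue_stateVisitation (π' : Kernel S A) [IsMarkovKernel π']
    (i : Fin (m + 1)) :
    ∫ s, M.stateValue π i s ∂(M.stateVisitation π') = (1 - M.γ) * M.value π i +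
      M.γ * ∫ x, ∫ s, M.stateValue π i s ∂(M.P x) ∂(M.visitation π') := by
  have hV (μ : Measure S) [IsFiniteMeasure μ] := M.integrable_stateValue π i μ
  rw [stateVisitation_eq_add, integral_ofReal_smul_add_ofReal_smul M.one_sub_γ_pos.le M.γ_nonneg
    (hV _) (hV _), integral_measureComp (hV _), ← value_eq_integral_stateValue]

theorem integral_actionValue_visitation (π' : Kernel S A) [IsMarkovKernel π'] (i : Fin (m + 1)) :
    ∫ x, M.actionValue π i x ∂(M.visitation π') = (1 - M.γ) * M.value π' i +
      M.γ * ∫ x, ∫ s, M.stateValue π i s ∂(M.P x) ∂(M.visitation π') := by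
  have hBellman (x : S × A) : M.γ * ∫ s, M.stateValue π i s ∂(M.P x) =
      M.actionValue π i x - M.r i x := by
    rw [actionValue_eq_add_integral_stateValue, add_sub_cancel_left]
  rw [value_eq_integral_visitation, mul_inv_cancel_left₀ M.one_sub_γ_pos.ne',
    ← integral_const_mul]
  simp_rw [hBellman]
  rw [integral_sub (M.integrable_actionValue π i _) (M.integrable_r i _), add_sub_cancel]

theorem value_sub_value (π' : Kernel S A) [IsMarkovKernel π'] (i : Fin (m + 1)) :
    M.value π' i - M.value π i =
      (1 - M.γ)⁻¹ * ∫ x, M.advantage π i x ∂(M.visitation π') := by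
  rw [integral_advantage_visitation, integral_actionValue_visitation,
    integral_stateValue_stateVisitation, add_sub_add_right_eq_sub, ← mul_sub,
    inv_mul_cancel_left₀ M.one_sub_γ_pos.ne']

end Values

end CMDP

/-! ### Likelihood ratios -/

namespace PolicyClass

variable {S A : Type*} [MeasurableSpace S] [MeasurableSpace A] {d : ℕ} (p : PolicyClass S A d)
  (θ θ' : EuclideanSpace ℝ (Fin d))

theorem hasGradientAt_log_dens (x : S × A) :
    HasGradientAt (fun θ' => Real.log (p.dens θ' x.1 x.2)) (p.score θ x) θ :=
  (p.differentiable_log_dens x.1 x.2 θ).hasGradientAt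

theorem measurable_score : Measurable (p.score θ) :=
  measurable_gradient_of_differentiableAt (fun θ' => (p.measurable_dens θ').log)
    fun x => p.differentiable_log_dens x.1 x.2 θ

/-- The likelihood ratio `π_θ'(a|s) / π_θ(a|s)`, which reweights expectations under `π_θ` to
expectations under `π_θ'`. -/
noncomputable def ratio (x : S × A) : ℝ := p.dens θ' x.1 x.2 / p.dens θ x.1 x.2

theorem ratio_self (x : S × A) : p.ratio θ θ x = 1 := div_self (p.dens_pos _ _ _).ne'

theorem ratio_pos (x : S × A) : 0 < p.ratio θ θ' x := div_pos (p.dens_pos _ _ _) (p.dens_pos _ _ _)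

theorem measurable_ratio : Measurable (p.ratio θ θ') :=
  (p.measurable_dens θ').div (p.measurable_dens θ)

theorem ratio_eq_exp (x : S × A) :
    p.ratio θ θ' x = Real.exp (Real.log (p.dens θ' x.1 x.2) - Real.log (p.dens θ x.1 x.2)) := by
  rw [Real.exp_sub, Real.exp_log (p.dens_pos _ _ _), Real.exp_log (p.dens_pos _ _ _), ratio]

theorem hasGradientAt_ratio (x : S × A) :
    HasGradientAt (fun θ' => p.ratio θ θ' x) (p.score θ x) θ := by
  have h := ((p.hasGradientAt_log_dens θ x).hasFDerivAt.sub_const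
    (Real.log (p.dens θ x.1 x.2))).exp
  simp only [← ratio_eq_exp, ratio_self, one_smul] at h
  exact h

theorem eventually_abs_ratio_sub_one_le {L : ℝ}
    (hL : ∀ᶠ θ' in 𝓝 θ, ∀ x, ‖p.score θ' x‖ ≤ L) :
    ∀ᶠ θ' in 𝓝 θ, ∀ x, |p.ratio θ θ' x - 1| ≤ 2 * L * ‖θ' - θ‖ := by
  obtain ⟨δ, hδ, hball⟩ := Metric.eventually_nhds_iff_ball.1 hL
  have hsmall : ∀ᶠ θ' in 𝓝 θ, L * ‖θ' - θ‖ < 1 :=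
    ContinuousAt.eventually_lt (by fun_prop) continuousAt_const (by simp)
  filter_upwards [hsmall, Metric.ball_mem_nhds θ hδ] with θ' hθ' hmem x
  have hlip := (convex_ball θ δ).norm_image_sub_le_of_norm_hasFDerivWithin_le
    (fun θ₁ _ => (p.hasGradientAt_log_dens θ₁ x).hasFDerivAt.hasFDerivWithinAt)
    (fun θ₁ h₁ => (LinearIsometryEquiv.norm_map _ _).trans_le (hball θ₁ h₁ x))
    (Metric.mem_ball_self hδ) hmem
  rw [p.ratio_eq_exp, mul_assoc]
  exact (Real.abs_exp_sub_one_le (hlip.trans hθ'.le)).trans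
    (mul_le_mul_of_nonneg_left hlip zero_le_two)

section CompProd

variable (σ : Measure S)

theorem compProd_policy [SFinite σ] :
    σ ⊗ₘ p.policy θ =
      (σ.prod p.ref).withDensity fun x => ENNReal.ofReal (p.dens θ x.1 x.2) := by
  have : IsSFiniteKernel ((Kernel.const S p.ref).withDensity
    fun s a => ENNReal.ofReal (p.dens θ s a)) := inferInstanceAs (IsSFiniteKernel (p.policy θ))
  rw [policy, Measure.compProd_withDensity (p.measurable_dens θ).ennreal_ofReal,
    Measure.compProd_const]

theorem compProd_policy_eq_withDensity_ratio [SFinite σ] :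
    σ ⊗ₘ p.policy θ' =
      (σ ⊗ₘ p.policy θ).withDensity fun x => ENNReal.ofReal (p.ratio θ θ' x) := by
  have hdens : Measurable fun x : S × A => ENNReal.ofReal (p.dens θ x.1 x.2) :=
    (p.measurable_dens θ).ennreal_ofReal
  rw [compProd_policy, compProd_policy,
    ← withDensity_mul _ hdens (p.measurable_ratio θ θ').ennreal_ofReal]
  congr with x
  rw [Pi.mul_apply, ← ENNReal.ofReal_mul (p.dens_pos _ _ _).le, ratio,
    mul_div_cancel₀ _ (p.dens_pos _ _ _).ne']

theorem integral_compProd_policy [SFinite σ] (f : S × A → ℝ) :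
    ∫ x, f x ∂(σ ⊗ₘ p.policy θ') = ∫ x, p.ratio θ θ' x * f x ∂(σ ⊗ₘ p.policy θ) := by
  rw [compProd_policy_eq_withDensity_ratio p θ θ', integral_withDensity_eq_integral_toReal_smul
    (p.measurable_ratio θ θ').ennreal_ofReal (.of_forall fun _ => ENNReal.ofReal_lt_top)]
  simp_rw [ENNReal.toReal_ofReal (p.ratio_pos θ θ' _).le, smul_eq_mul]

theorem integrable_compProd_policy_iff [SFinite σ] {f : S × A → ℝ} :
    Integrable f (σ ⊗ₘ p.policy θ') ↔
      Integrable (fun x => p.ratio θ θ' x * f x) (σ ⊗ₘ p.policy θ) := by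
  rw [compProd_policy_eq_withDensity_ratio p θ θ', integrable_withDensity_iff
    (p.measurable_ratio θ θ').ennreal_ofReal (.of_forall fun _ => ENNReal.ofReal_lt_top)]
  simp_rw [ENNReal.toReal_ofReal (p.ratio_pos θ θ' _).le, mul_comm]

variable [IsFiniteMeasure σ]

theorem integrable_ratio : Integrable (p.ratio θ θ') (σ ⊗ₘ p.policy θ) := by
  simpa using (p.integrable_compProd_policy_iff θ θ' σ).1 (integrable_const 1)

theorem integral_ratio : ∫ x, p.ratio θ θ' x ∂(σ ⊗ₘ p.policy θ) = σ.real .univ := by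
  simpa [measureReal_def, Measure.compProd_apply_univ] using
    (p.integral_compProd_policy θ θ' σ fun _ => 1).symm

theorem tendsto_integral_abs_ratio_sub_one :
    Tendsto (fun θ' => ∫ x, |p.ratio θ θ' x - 1| ∂(σ ⊗ₘ p.policy θ)) (𝓝 θ) (𝓝 0) := by
  refine tendsto_integral_abs_sub_of_tendsto_integral (p.integrable_ratio θ · σ)
    (fun θ' => .of_forall fun x => (p.ratio_pos θ θ' x).le) (integrable_const 1)
    (.of_forall fun x => ?_) ?_
  · simpa only [ratio_self] using (p.hasGradientAt_ratio θ x).hasFDerivAt.continuousAt.tendsto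
  · simp [integral_ratio, measureReal_def, Measure.compProd_apply_univ]

end CompProd

end PolicyClass

/-! ### The policy gradient theorem -/

namespace CMDP

variable {S A : Type*} [MeasurableSpace S] [MeasurableSpace A] {m d : ℕ}

section PolicyGradient

variable (M : CMDP S A m) (p : PolicyClass S A d) (i : Fin (m + 1))
  (θ θ' : EuclideanSpace ℝ (Fin d))

theorem integrable_ratio : Integrable (p.ratio θ θ') (M.visitation (p.policy θ)) := by
  rw [visitation_eq_compProd]
  exact p.integrable_ratio θ θ' _

theorem integral_stateValue_policy :
    ∫ s, M.stateValue (p.policy θ') i s ∂(M.stateVisitation (p.policy θ)) =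
      ∫ x, p.ratio θ θ' x * M.actionValue (p.policy θ') i x ∂(M.visitation (p.policy θ)) := by
  rw [integral_stateValue, p.integral_compProd_policy θ θ', ← visitation_eq_compProd]

theorem integrable_ratio_mul_actionValue :
    Integrable (fun x => p.ratio θ θ' x * M.actionValue (p.policy θ') i x)
      (M.visitation (p.policy θ)) := by
  rw [visitation_eq_compProd]
  exact (p.integrable_compProd_policy_iff θ θ' _).1 (M.integrable_actionValue _ i _)

theorem paramValue_sub_paramValue :
    M.paramValue p i θ' - M.paramValue p i θ = (1 - M.γ)⁻¹ *
      ∫ x, (p.ratio θ θ' x - 1) * M.actionValue (p.policy θ') i x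
        ∂(M.visitation (p.policy θ)) := by
  simp_rw [sub_one_mul]
  rw [integral_sub (M.integrable_ratio_mul_actionValue p i θ θ') (M.integrable_actionValue _ i _),
    ← integral_stateValue_policy, ← neg_sub, paramValue, paramValue, value_sub_value,
    integral_advantage_visitation, ← mul_neg, neg_sub]

theorem abs_paramValue_sub_paramValue_le :
    |M.paramValue p i θ' - M.paramValue p i θ| ≤ (1 - M.γ)⁻¹ * ((1 - M.γ)⁻¹ *
      ∫ x, |p.ratio θ θ' x - 1| ∂(M.visitation (p.policy θ))) := by
  rw [paramValue_sub_paramValue, abs_mul, abs_of_nonneg M.inv_one_sub_γ_nonneg,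
    ← integral_const_mul]
  have hint : Integrable (fun x => |p.ratio θ θ' x - 1|) (M.visitation (p.policy θ)) :=
    ((M.integrable_ratio p θ θ').sub (integrable_const 1)).abs
  refine mul_le_mul_of_nonneg_left ?_ M.inv_one_sub_γ_nonneg
  rw [← Real.norm_eq_abs]
  refine norm_integral_le_of_norm_le (hint.const_mul _) (.of_forall fun x => ?_)
  rw [norm_mul, mul_comm]
  exact mul_le_mul_of_nonneg_right (M.norm_actionValue_le _ i x) (abs_nonneg _)

theorem continuous_paramValue : Continuous (M.paramValue p i) := by
  refine continuous_iff_continuousAt.2 fun θ => tendsto_iff_norm_sub_tendsto_zero.2 ?_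
  have hlim := ((p.tendsto_integral_abs_ratio_sub_one θ (M.stateVisitation (p.policy θ))).const_mul
    (1 - M.γ)⁻¹).const_mul (1 - M.γ)⁻¹
  rw [mul_zero, mul_zero, ← visitation_eq_compProd] at hlim
  exact squeeze_zero (fun _ => norm_nonneg _)
    (fun θ' => M.abs_paramValue_sub_paramValue_le p i θ θ') hlim

theorem continuous_actionValue (x : S × A) :
    Continuous fun θ => M.actionValue (p.policy θ) i x := by
  simp_rw [actionValue_eq_add_value]
  exact (((M.withInitialLaw (M.P x)).continuous_paramValue p i).const_mul _).const_add _

theorem hasGradientAt_ratio_sub_one_mul_actionValue (x : S × A) :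
    HasGradientAt (fun θ' => (p.ratio θ θ' x - 1) * M.actionValue (p.policy θ') i x)
      (M.actionValue (p.policy θ) i x • p.score θ x) θ := by
  refine (hasFDerivAt_smul_of_eq_zero ((p.hasGradientAt_ratio θ x).hasFDerivAt.sub_const 1)
    (sub_eq_zero.2 (p.ratio_self θ x))
    (M.continuous_actionValue p i x).continuousAt).congr_fderiv ?_
  ext v
  simp [mul_comm]

variable {M p θ}

theorem eventually_norm_score_le {L : ℝ} (hL : M.BoundedScore p L)
    (hθ : ∀ i : Fin m, 0 < M.paramValue p i.succ θ) :
    ∀ᶠ θ' in 𝓝 θ, ∀ x, ‖p.score θ' x‖ ≤ L := by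
  have hpos := eventually_all.2 fun i : Fin m =>
    (M.continuous_paramValue p i.succ).continuousAt.eventually_const_lt (hθ i)
  filter_upwards [hpos] with θ' hθ' using hL θ' fun i => (hθ' i).le

theorem hasGradientAt_paramValue {L : ℝ} (hL : ∀ᶠ θ' in 𝓝 θ, ∀ x, ‖p.score θ' x‖ ≤ L) :
    HasGradientAt (M.paramValue p i) ((1 - M.γ)⁻¹ •
      ∫ x, M.actionValue (p.policy θ) i x • p.score θ x ∂(M.visitation (p.policy θ))) θ := by
  have hQ (θ' : EuclideanSpace ℝ (Fin d)) := M.measurable_actionValue (p.policy θ') i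
  have hint : HasGradientAt
      (fun θ' => ∫ x, (p.ratio θ θ' x - 1) * M.actionValue (p.policy θ') i x
        ∂(M.visitation (p.policy θ)))
      (∫ x, M.actionValue (p.policy θ) i x • p.score θ x ∂(M.visitation (p.policy θ))) θ := by
    refine hasGradientAt_integral_of_dominated_loc_of_lip
      (bound := fun _ => 2 * L * (1 - M.γ)⁻¹) (p.eventually_abs_ratio_sub_one_le θ hL)
      (fun θ' _ => (((p.measurable_ratio θ θ').sub_const 1).mul (hQ θ')).aestronglyMeasurable)
      (by simp [p.ratio_self]) ((hQ θ).smul (p.measurable_score θ)).aestronglyMeasurable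
      (.of_forall fun x θ' hθ' => ?_) (integrable_const _)
      (.of_forall (M.hasGradientAt_ratio_sub_one_mul_actionValue p i θ))
    rw [p.ratio_self, sub_self, zero_mul, sub_zero, abs_mul, mul_right_comm]
    exact mul_le_mul (hθ' x) (M.norm_actionValue_le _ i x) (abs_nonneg _)
      ((abs_nonneg _).trans (hθ' x))
  have hV : M.paramValue p i = fun θ' => M.paramValue p i θ + (1 - M.γ)⁻¹ *
      ∫ x, (p.ratio θ θ' x - 1) * M.actionValue (p.policy θ') i x
        ∂(M.visitation (p.policy θ)) := by
    funext θ'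
    rw [← paramValue_sub_paramValue, add_sub_cancel]
  rw [hV]
  refine ((hint.hasFDerivAt.const_mul _).const_add _).congr_fderiv ?_
  rw [map_smul]

theorem differentiableAt_paramValue {L : ℝ} (hL : ∀ᶠ θ' in 𝓝 θ, ∀ x, ‖p.score θ' x‖ ≤ L) :
    DifferentiableAt ℝ (M.paramValue p i) θ :=
  (hasGradientAt_paramValue i hL).differentiableAt

theorem hasGradientAt_logBarrier (η : ℝ) (hV : ∀ i, DifferentiableAt ℝ (M.paramValue p i) θ)
    (hθ : ∀ i : Fin m, M.paramValue p i.succ θ ≠ 0) :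
    HasGradientAt (M.logBarrier p η) (gradient (M.paramValue p 0) θ +
      ∑ i : Fin m, (η / M.paramValue p i.succ θ) • gradient (M.paramValue p i.succ) θ) θ :=
  hasGradientAt_add_const_mul_sum_log η (hV 0).hasGradientAt
    (fun i => (hV i.succ).hasGradientAt) hθ

end PolicyGradient

/-! ### Compatible function approximation -/

section CompatibleApproximation

variable {M : CMDP S A m} {p : PolicyClass S A d} {θ : EuclideanSpace ℝ (Fin d)}

theorem naturalGradient_add_sum_smul (η : ℝ)
    (hV : ∀ i, DifferentiableAt ℝ (M.paramValue p i) θ)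
    (hθ : ∀ i : Fin m, M.paramValue p i.succ θ ≠ 0) :
    M.naturalGradient p 0 θ +
      ∑ i : Fin m, (η / M.paramValue p i.succ θ) • M.naturalGradient p i.succ θ =
      Matrix.toEuclideanLin (symmPinv (M.fisher p θ)) (gradient (M.logBarrier p η) θ) := by
  rw [(hasGradientAt_logBarrier η hV hθ).gradient]
  simp only [naturalGradient, map_add, map_sum, map_smul]

theorem value_sub_value_le_of_integral_sq_le {π π' : Kernel S A} [IsMarkovKernel π]
    [IsMarkovKernel π'] {i : Fin (m + 1)} {ψ : S × A → ℝ} (hψ : MemLp ψ 2 (M.visitation π')) {ε : ℝ}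
    (hε : ∫ x, (M.advantage π i x - (1 - M.γ) * ψ x) ^ 2 ∂(M.visitation π') ≤ ε) :
    M.value π' i - M.value π i ≤ √ε / (1 - M.γ) + ∫ x, ψ x ∂(M.visitation π') := by
  have hA : MemLp (M.advantage π i) 2 (M.visitation π') :=
    .of_bound (M.measurable_advantage π i).aestronglyMeasurable _
      (.of_forall (M.norm_advantage_le π i))
  have hCS := (integral_le_sqrt_integral_sq (hA.sub (hψ.const_mul (1 - M.γ)))).trans
    (Real.sqrt_le_sqrt hε)
  have hsub := integral_sub (hA.integrable one_le_two)
    ((hψ.integrable one_le_two).const_mul (1 - M.γ))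
  rw [integral_const_mul] at hsub
  rw [value_sub_value, div_eq_inv_mul, inv_mul_le_iff₀ M.one_sub_γ_pos, mul_add,
    mul_inv_cancel_left₀ M.one_sub_γ_pos.ne']
  exact sub_le_iff_le_add.1 (hsub.ge.trans hCS)

theorem value_sub_paramValue_le {π' : Kernel S A} [IsMarkovKernel π'] {ε : ℝ}
    (hscore : MemLp (p.score θ) 2 (M.visitation π'))
    (hbias : M.BoundedTransferErrorAt p π' θ ε) (i : Fin (m + 1)) :
    M.value π' i - M.paramValue p i θ ≤ √ε / (1 - M.γ) +
      inner ℝ (M.naturalGradient p i θ) (∫ x, p.score θ x ∂(M.visitation π')) := by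
  rw [← integral_inner (hscore.integrable one_le_two)]
  exact value_sub_value_le_of_integral_sq_le (hscore.const_inner _) (hbias i)

end CompatibleApproximation

end CMDP

theorem mainTheorem4_general {S A : Type*} [MeasurableSpace S] [MeasurableSpace A] {m d : ℕ}
    (M : CMDP S A m) (p : PolicyClass S A d)
    (π' : Kernel S A) [IsMarkovKernel π'] (hfeas : ∀ i : Fin m, 0 ≤ M.value π' i.succ)
    (θ : EuclideanSpace ℝ (Fin d))
    (Mg : ℝ) (hscore : ∀ᶠ θ' in 𝓝 θ, ∀ x, ‖p.score θ' x‖ ≤ Mg)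
    (η : ℝ) (hη : 0 ≤ η) (hθ : ∀ i : Fin m, 0 < M.paramValue p i.succ θ)
    (μF : ℝ) (hμF : 0 < μF) (hF : M.RelaxedFisherNondegenerateAt p θ μF)
    (εbias : ℝ) (hbias : M.BoundedTransferErrorAt p π' θ εbias) :
    (∀ i, DifferentiableAt ℝ (M.paramValue p i) θ) ∧
      DifferentiableAt ℝ (M.logBarrier p η) θ ∧
      M.value π' 0 - M.paramValue p 0 θ ≤
        m * η
          + √εbias / (1 - M.γ) * (1 + ∑ i : Fin m, η / M.paramValue p i.succ θ)
          + Mg / μF * ‖gradient (M.logBarrier p η) θ‖ := by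
  have hV i := CMDP.differentiableAt_paramValue (M := M) i hscore
  have hθ' i := (hθ i).ne'
  refine ⟨hV, (CMDP.hasGradientAt_logBarrier η hV hθ').differentiableAt, ?_⟩
  have hgap := CMDP.value_sub_paramValue_le (.of_bound
    (p.measurable_score θ).aestronglyMeasurable Mg (.of_forall hscore.self_of_nhds)) hbias
  refine (sub_le_of_barrier_multipliers hη hθ hfeas (hgap 0) (fun i => hgap i.succ)).trans ?_
  rw [Fintype.card_fin]
  gcongr
  set g := ∫ x, p.score θ x ∂(M.visitation π')
  have hg : ‖g‖ ≤ Mg := by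
    simpa using norm_integral_le_of_norm_le_const (μ := M.visitation π')
      (.of_forall hscore.self_of_nhds)
  simp_rw [← real_inner_smul_left]
  rw [← sum_inner, ← inner_add_left, CMDP.naturalGradient_add_sum_smul η hV hθ']
  calc inner ℝ _ g
      ≤ ‖Matrix.toEuclideanLin (symmPinv (M.fisher p θ)) (gradient (M.logBarrier p η) θ)‖ * ‖g‖ :=
        real_inner_le_norm _ _
    _ ≤ μF⁻¹ * ‖gradient (M.logBarrier p η) θ‖ * Mg := by
        gcongr; exact norm_toEuclideanLin_symmPinv_le hμF hF _
    _ = Mg / μF * ‖gradient (M.logBarrier p η) θ‖ := by ring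

theorem mainTheorem4 {S A : Type*} [MeasurableSpace S] [MeasurableSpace A] {m d : ℕ}
    (M : CMDP S A m) (p : PolicyClass S A d)
    (πstar : Kernel S A) [IsMarkovKernel πstar] (hopt : M.IsOptimalPolicy πstar)
    (Mg : ℝ) (hscore : M.BoundedScore p Mg)
    (η : ℝ) (hη : 0 < η)
    (θ : EuclideanSpace ℝ (Fin d)) (hθ : ∀ i : Fin m, 0 < M.paramValue p i.succ θ)
    (μF : ℝ) (hμF : 0 < μF) (hF : M.RelaxedFisherNondegenerateAt p θ μF)
    (εbias : ℝ) (hbias : M.BoundedTransferErrorAt p πstar θ εbias) :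
    (∀ i, DifferentiableAt ℝ (M.paramValue p i) θ) ∧
      DifferentiableAt ℝ (M.logBarrier p η) θ ∧
      M.value πstar 0 - M.paramValue p 0 θ ≤
        m * η
          + Real.sqrt εbias / (1 - M.γ) * (1 + ∑ i : Fin m, η / M.paramValue p i.succ θ)
          + Mg / μF * ‖gradient (M.logBarrier p η) θ‖ := by
  exact mainTheorem4_general M p πstar hopt.1 θ Mg (CMDP.eventually_norm_score_le hscore hθ)
    η hη.le hθ μF hμF hF εbias hbias
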